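/- Fix a signature $\mathcal F$ and an infinite set $\mathcal V$ of variables; substitutions map variables to terms and have finite domain. An equational system (ES) is a set of pairs of terms. For an ES $\mathcal E$, write $s \to_{\mathcal E} t$ if $s|_p = \ell\sigma$ and $t = s[r\sigma]_p$ for some $(\ell,r)\in\mathcal E$, position $p$ and substitution $\sigma$, and put $\mathcal E^{\pm} = \mathcal E \cup \{(r,\ell) \mid (\ell,r)\in\mathcal E\}$. A term rewrite system (TRS) is an ES whose pairs $(\ell,r)$ (rules, written $\ell\to r$) satisfy: $\ell$ is not a variable and $\mathrm{Var}(r)\subseteq \mathrm{Var}(\ell)$. It is left-linear if no variable occurs twice in the left-hand side $\ell$ of any rule. Let $\mathcal R$ be a TRS and $\mathcal B$ an ES with $\mathrm{Var}(\ell)=\mathrm{Var}(r)$ for all $(\ell, r)\in\mathcal B$. Let $\sim$ be the reflexive, symmetric and transitive closure of $\to_{\mathcal B}$, and write $s\downarrow^{\sim}_{\mathcal R} t$ if $s \to_{\mathcal R}^* \cdot \sim \cdot \mathrel{{}_{\mathcal R}^{\,*}{\leftarrow}} t$. $\mathcal R$ is terminating modulo $\mathcal B$ if there is no infinite sequence of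 steps of $\sim\cdot\to_{\mathcal R}\cdot\sim$, and Church–Rosser modulo $\mathcal B$ if $({\leftarrow_{\mathcal R}}\cup{\to_{\mathcal R}}\cup{\sim})^* \subseteq {\downarrow^{\sim}_{\mathcal R}}$. For ESs $\mathcal E_1,\mathcal E_2$, an overlap of $\mathcal E_1$ on $\mathcal E_2$ consists of variants $(\ell_1, r_1)$ of a pair in $\mathcal E_1$ and $(\ell_2, r_2)$ of a pair in $\mathcal E_2$ without common variables, and a function-symbol position $p$ of $\ell_2$ such that $\ell_1$ and $\ell_2|_p$ are unifiable and, if $p=\epsilon$, the two pairs are not variants of each other. For any most general unifier $\sigma$ of $\ell_1$ and $\ell_2|_p$, it yields the critical pair $\ell_2\sigma[r_1\sigma]_p \approx r_2\sigma$, which is prime (with respect to $\mathcal R$) if all proper subterms of $(\ell_2\sigma)|_p$ are in normal form with respect to $\to_{\mathcal R}$. Let $\mathrm{PCP}(\mathcal R)$ be the set of all prime critical pairs obtained from overlaps of $\mathcal R$ on $\mathcal R$, and $\mathrm{PCP}^{\pm}(\mathcal R,\mathcal B^{\pm})$ the set of all prime critical pairs (with respect to $\mathcal R$) obtained from overlaps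 of $\mathcal R$ on $\mathcal B^{\pm}$ or of $\mathcal B^{\pm}$ on $\mathcal R$. Theorem. If $\mathcal R$ is left-linear and terminating modulo $\mathcal B$, then $\mathcal R$ is Church–Rosser modulo $\mathcal B$ if and only if $\mathrm{PCP}(\mathcal R)\cup \mathrm{PCP}^{\pm}(\mathcal R,\mathcal B^{\pm}) \subseteq {\downarrow^{\sim}_{\mathcal R}}$. -/

import Mathlib

namespace TermRewriting

section Abstract

variable {A : Type*}

/-- The composition `∼ · → · ∼`: rewriting with `r` modulo `e`. -/
def RewriteModulo (r e : A → A → Prop) (a b : A) : Prop :=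
  ∃ c d, e a c ∧ r c d ∧ e d b

/-- One step of a conversion modulo `e`, i.e. a step of `← ∪ → ∪ ∼`. -/
def ConversionStep (r e : A → A → Prop) (a b : A) : Prop := r b a ∨ r a b ∨ e a b

/-- Valleys modulo `e`: the composition `→* · ∼ · *←`. -/
def Valley (r e : A → A → Prop) (a b : A) : Prop :=
  ∃ c d, Relation.ReflTransGen r a c ∧ e c d ∧ Relation.ReflTransGen r b d

/-- There is no infinite sequence of steps of `∼ · → · ∼`. -/
def TerminatingModulo (r e : A → A → Prop) : Prop :=
  ¬ ∃ f : ℕ → A, ∀ n, RewriteModulo r e (f n) (f (n + 1))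

/-- Every conversion modulo `e` is a valley modulo `e`. -/
def ChurchRosserModulo (r e : A → A → Prop) : Prop :=
  ∀ a b, Relation.ReflTransGen (ConversionStep r e) a b → Valley r e a b

/-- `a` admits no `r`-step. -/
def IsNormalForm (r : A → A → Prop) (a : A) : Prop := ∀ b, ¬ r a b

end Abstract

section Terms

/- The signature is given by the function symbols of `L`, the variables are the elements of `V`. -/
variable {L : FirstOrder.Language} {V : Type*}

open Classical in
/-- The set of variables of a term. -/
noncomputable def vars (t : L.Term V) : Finset V := t.varFinset

/-- The subterm of a term at a position (a sequence of argument indices, counted from `0`);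
`none` if the sequence is not a position of the term. -/
def subtermAt : L.Term V → List ℕ → Option (L.Term V)
  | t, [] => some t
  | .var _, _ :: _ => none
  | .func (l := n) _ ts, i :: p => if h : i < n then subtermAt (ts ⟨i, h⟩) p else none

/-- `replaceAt s p t` is `s[t]_p`; it is only used for positions `p` of `s`. -/
def replaceAt : L.Term V → List ℕ → L.Term V → L.Term V
  | _, [], t => t
  | .var x, _ :: _, _ => .var x
  | .func f ts, i :: p, t =>
      .func f fun j => if (j : ℕ) = i then replaceAt (ts j) p t else ts j

/-- A term is linear if no variable occurs at two different positions. -/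
def IsLinear (t : L.Term V) : Prop :=
  ∀ (x : V) (p q : List ℕ),
    subtermAt t p = some (.var x) → subtermAt t q = some (.var x) → p = q

/-- Substitutions are maps from variables to terms with a finite domain. -/
def IsSubstitution (σ : V → L.Term V) : Prop := {x | σ x ≠ .var x}.Finite

/-- Renamings are substitutions that permute the variables. -/
def IsRenaming (σ : V → L.Term V) : Prop :=
  IsSubstitution σ ∧ ∃ π : Equiv.Perm V, ∀ x, σ x = .var (π x)

/-- `σ` is a unifier of `s` and `t`. -/
def IsUnifier (σ : V → L.Term V) (s t : L.Term V) : Prop :=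
  IsSubstitution σ ∧ s.subst σ = t.subst σ

/-- `σ` is a most general unifier of `s` and `t`. -/
def IsMGU (σ : V → L.Term V) (s t : L.Term V) : Prop :=
  IsUnifier σ s t ∧
    ∀ τ, IsUnifier τ s t → ∃ ρ, IsSubstitution ρ ∧ ∀ x, τ x = (σ x).subst ρ

end Terms

section Rewriting

variable {L : FirstOrder.Language} {V : Type*}

/-- Equational systems are sets of pairs of terms. A pair is an equation or, oriented from left
to right, a rule. -/
abbrev ES (L : FirstOrder.Language) (V : Type*) := Set (L.Term V × L.Term V)

/-- In a term rewrite system, left-hand sides are not variables and contain all variables of the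
corresponding right-hand sides. -/
def IsTRS (R : ES L V) : Prop :=
  ∀ ρ ∈ R, (∀ x, ρ.1 ≠ .var x) ∧ vars ρ.2 ⊆ vars ρ.1

/-- All left-hand sides are linear. -/
def IsLeftLinear (R : ES L V) : Prop := ∀ ρ ∈ R, IsLinear ρ.1

/-- `E^±`: the equations of `E` in both orientations. -/
def symmES (E : ES L V) : ES L V := E ∪ {ρ | ρ.swap ∈ E}

/-- `s` rewrites to `t` with a pair of `E` at position `p`. -/
def StepAt (E : ES L V) (p : List ℕ) (s t : L.Term V) : Prop :=
  ∃ ρ ∈ E, ∃ σ, IsSubstitution σ ∧ subtermAt s p = some (ρ.1.subst σ) ∧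
    t = replaceAt s p (ρ.2.subst σ)

/-- The rewrite relation of `E`. -/
def Step (E : ES L V) (s t : L.Term V) : Prop := ∃ p, StepAt E p s t

/-- The equational theory of `E`: the reflexive transitive closure of the symmetric closure of
the rewrite relation. -/
def EqTheory (E : ES L V) : L.Term V → L.Term V → Prop :=
  Relation.ReflTransGen (Relation.SymmGen (Step E))

/-- The second pair is a variant of the first one. -/
def IsVariant (ρ ρ' : L.Term V × L.Term V) : Prop :=
  ∃ σ, IsRenaming σ ∧ ρ.1.subst σ = ρ'.1 ∧ ρ.2.subst σ = ρ'.2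

/-- `⟨ρ₁, p, ρ₂⟩` is an overlap, where `ρ₁` stems from `E₁` and `ρ₂` stems from `E₂`. -/
structure IsOverlap (E₁ E₂ : ES L V) (ρ₁ : L.Term V × L.Term V) (p : List ℕ)
    (ρ₂ : L.Term V × L.Term V) : Prop where
  variant_left : ∃ ρ ∈ E₁, IsVariant ρ ρ₁
  variant_right : ∃ ρ ∈ E₂, IsVariant ρ ρ₂
  disjoint : ∀ x, (x ∈ vars ρ₁.1 ∨ x ∈ vars ρ₁.2) → ¬ (x ∈ vars ρ₂.1 ∨ x ∈ vars ρ₂.2)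
  unifiable : ∃ (n : ℕ) (f : L.Functions n) (ts : Fin n → L.Term V),
    subtermAt ρ₂.1 p = some (.func f ts) ∧ ∃ σ, IsUnifier σ ρ₁.1 (.func f ts)
  not_variant : p = [] → ¬ IsVariant ρ₁ ρ₂

/-- `⟨t, p, s, u⟩` is a critical peak: `s` rewrites to `t` at position `p` with a pair from `E₁`
and to `u` at the root with a pair from `E₂`, as prescribed by an overlap and a most general
unifier. -/
def IsCriticalPeak (E₁ E₂ : ES L V) (t : L.Term V) (p : List ℕ) (s u : L.Term V) : Prop :=
  ∃ ρ₁ ρ₂ w σ, IsOverlap E₁ E₂ ρ₁ p ρ₂ ∧ subtermAt ρ₂.1 p = some w ∧ IsMGU σ ρ₁.1 w ∧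
    s = ρ₂.1.subst σ ∧ t = replaceAt (ρ₂.1.subst σ) p (ρ₁.2.subst σ) ∧ u = ρ₂.2.subst σ

/-- A peak with source `s` and inner position `p` is prime if all proper subterms of `s|_p` are
in normal form with respect to `R`. -/
def IsPrimePeak (R : ES L V) (p : List ℕ) (s : L.Term V) : Prop :=
  ∀ w, subtermAt s p = some w →
    ∀ q v, q ≠ [] → subtermAt w q = some v → IsNormalForm (Step R) v

/-- The critical pairs obtained from overlaps of `E₁` on `E₂` whose peak is prime with respect
to `R`. -/
def primeCPs (R E₁ E₂ : ES L V) : Set (L.Term V × L.Term V) :=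
  {e | ∃ p s, IsCriticalPeak E₁ E₂ e.1 p s e.2 ∧ IsPrimePeak R p s}

/-- The prime critical pairs of `R`. -/
def PCP (R : ES L V) : Set (L.Term V × L.Term V) := primeCPs R R R

/-- The prime critical pairs between `R` and `E`, in both directions; irreducibility is always
checked with respect to `R`. -/
def PCPpm (R E : ES L V) : Set (L.Term V × L.Term V) := primeCPs R R E ∪ primeCPs R E R

end Rewriting

end TermRewriting

/-! If `R` is Church–Rosser modulo `∼`, each critical pair is a conversion through the source of its
peak, hence a valley.

For the converse, take a step `s → t` together with a second step of `R` or `B^±` from `s` to `u`.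
Since `s` is reducible, it has an innermost step `s → v`, all proper subterms of whose redex are
normal forms (`exists_innermost_step`). Both pairs `(t, v)` and `(v, u)` then come from a peak or
cliff one side of which is this prime step, and `valley_of_primeCPs` closes each of them by a
valley: function-position overlaps are trivial or instances of prime critical pairs
(`exists_mem_primeCPs`), and parallel or variable overlaps always close. Left-linearity enters only
when a `B`-step takes place inside the substitution part of an `R`-redex: that redex must survive.

The two valleys need not combine into one valley from `t` to `u`. It is enough that `v` is a proper
reduct of `s`: well-founded induction along `∼ · → · ∼` shows that equivalent elements have
equivalent normal forms (`equiv_of_isNormalFormOf`), whence the Church–Rosser property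
(`churchRosserModulo_of_local`).

Critical pairs require most general unifiers, built by variable elimination and decomposition in
`exists_isPrincipalSolution`. -/

namespace TermRewriting

open FirstOrder.Language (Term)
open Relation (ReflTransGen TransGen)

/-! ### Substitutions and variables of terms -/

section TermBasics

variable {L : FirstOrder.Language} {V : Type*}

theorem subst_var (x : V) (σ : V → L.Term V) : (Term.var x : L.Term V).subst σ = σ x := rfl

theorem subst_func {n : ℕ} (f : L.Functions n) (ts : Fin n → L.Term V) (σ : V → L.Term V) :
    (Term.func f ts).subst σ = Term.func f fun i => (ts i).subst σ := rfl

theorem subst_id (t : L.Term V) : t.subst Term.var = t := by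
  induction t with
  | var x => rfl
  | func f ts ih => simp only [subst_func, ih]

theorem subst_subst (t : L.Term V) (σ τ : V → L.Term V) :
    (t.subst σ).subst τ = t.subst fun x => (σ x).subst τ := by
  induction t with
  | var x => rfl
  | func f ts ih => simp only [subst_func, ih]

theorem mem_vars_var {x y : V} : x ∈ vars (Term.var y : L.Term V) ↔ x = y := by
  simp [vars, Term.varFinset]

theorem mem_vars_func {x : V} {n : ℕ} {f : L.Functions n} {ts : Fin n → L.Term V} :
    x ∈ vars (Term.func f ts) ↔ ∃ i, x ∈ vars (ts i) := by
  simp [vars, Term.varFinset]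

theorem subst_eq_subst_iff {t : L.Term V} {σ τ : V → L.Term V} :
    t.subst σ = t.subst τ ↔ ∀ x ∈ vars t, σ x = τ x := by
  induction t with
  | var x => simp [mem_vars_var]
  | func f ts ih =>
    simp only [subst_func, mem_vars_func, Term.func.injEq, heq_eq_eq, true_and, funext_iff, ih]
    exact ⟨fun h x ⟨i, hi⟩ => h i x hi, fun h i x hi => h x ⟨i, hi⟩⟩

theorem mem_vars_subst {t : L.Term V} {σ : V → L.Term V} {x : V} :
    x ∈ vars (t.subst σ) ↔ ∃ y ∈ vars t, x ∈ vars (σ y) := by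
  induction t with
  | var y => simp [mem_vars_var]
  | func f ts ih =>
    simp only [subst_func, mem_vars_func, ih]
    exact ⟨fun ⟨i, y, hy, hx⟩ => ⟨y, ⟨i, hy⟩, hx⟩, fun ⟨y, ⟨i, hy⟩, hx⟩ => ⟨i, y, hy, hx⟩⟩

theorem exists_subtermAt_of_mem_vars {t : L.Term V} {x : V} (hx : x ∈ vars t) :
    ∃ p, subtermAt t p = some (.var x) := by
  induction t with
  | var y => exact ⟨[], by rw [mem_vars_var.1 hx, subtermAt]⟩
  | func f ts ih =>
    obtain ⟨i, hi⟩ := mem_vars_func.1 hx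
    obtain ⟨p, hp⟩ := ih i hi
    exact ⟨i :: p, by simpa [subtermAt] using hp⟩

theorem isSubstitution_var : IsSubstitution (Term.var : V → L.Term V) := by
  simp [IsSubstitution]

theorem IsSubstitution.comp {σ τ : V → L.Term V} (hσ : IsSubstitution σ)
    (hτ : IsSubstitution τ) : IsSubstitution fun x => (σ x).subst τ := by
  refine (hσ.union hτ).subset fun x hx => ?_
  by_contra h
  simp only [Set.mem_union, Set.mem_ofPred_eq, not_or, not_not] at h
  exact hx (by simp only [h.1, subst_var, h.2])

theorem IsSubstitution.update [DecidableEq V] {σ : V → L.Term V} (hσ : IsSubstitution σ) (x : V)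
    (v : L.Term V) : IsSubstitution (Function.update σ x v) := by
  refine (hσ.insert x).subset fun y hy => ?_
  by_cases h : y = x
  · exact Or.inl h
  · right
    simpa [Function.update_of_ne h] using hy

end TermBasics

/-! ### Subterms and replacement at positions -/

section Positions

variable {L : FirstOrder.Language} {V : Type*}

theorem subtermAt_nil (t : L.Term V) : subtermAt t [] = some t := by cases t <;> rfl

theorem replaceAt_nil (s t : L.Term V) : replaceAt s [] t = t := by cases s <;> rfl

theorem subtermAt_append (s : L.Term V) (p q : List ℕ) :
    subtermAt s (p ++ q) = (subtermAt s p).bind fun w => subtermAt w q := by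
  induction p generalizing s with
  | nil => simp [subtermAt_nil]
  | cons i p ih =>
    cases s with
    | var x => rfl
    | func f ts =>
      simp only [List.cons_append, subtermAt]
      split
      · exact ih _
      · rfl

theorem subtermAt_append_of_eq {s w : L.Term V} {p : List ℕ} (h : subtermAt s p = some w)
    (q : List ℕ) : subtermAt s (p ++ q) = subtermAt w q := by
  rw [subtermAt_append, h, Option.bind_some]

/-- Case distinction on a position below the root. -/
theorem subtermAt_cons_eq_some {s w : L.Term V} {i : ℕ} {p : List ℕ}
    (h : subtermAt s (i :: p) = some w) :
    ∃ (n : ℕ) (f : L.Functions n) (ts : Fin n → L.Term V) (j : Fin n),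
      s = .func f ts ∧ (j : ℕ) = i ∧ subtermAt (ts j) p = some w := by
  cases s with
  | var x => simp [subtermAt] at h
  | func f ts =>
    simp only [subtermAt] at h
    split at h
    · next hi => exact ⟨_, f, ts, ⟨i, hi⟩, rfl, rfl, h⟩
    · simp at h

theorem replaceAt_func {n : ℕ} (f : L.Functions n) (ts : Fin n → L.Term V) (j : Fin n)
    (p : List ℕ) (t : L.Term V) [DecidableEq (Fin n)] :
    replaceAt (.func f ts) (j :: p) t = .func f (Function.update ts j (replaceAt (ts j) p t)) := by
  simp only [replaceAt, Term.func.injEq, heq_eq_eq, true_and]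
  funext k
  by_cases h : k = j
  · subst h; simp
  · rw [if_neg (fun hk => h (Fin.ext hk)), Function.update_of_ne h]

theorem subtermAt_func {n : ℕ} (f : L.Functions n) (ts : Fin n → L.Term V) (j : Fin n)
    (p : List ℕ) : subtermAt (.func f ts) (j :: p) = subtermAt (ts j) p := by
  simp [subtermAt]

theorem replaceAt_append {s w : L.Term V} {p : List ℕ} (h : subtermAt s p = some w) (q : List ℕ)
    (t : L.Term V) : replaceAt s (p ++ q) t = replaceAt s p (replaceAt w q t) := by
  induction p generalizing s with
  | nil =>
    rw [subtermAt_nil, Option.some.injEq] at h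
    simp [replaceAt_nil, h]
  | cons i p ih =>
    obtain ⟨n, f, ts, j, rfl, rfl, h₀⟩ := subtermAt_cons_eq_some h
    rw [List.cons_append, replaceAt_func, replaceAt_func, ih h₀]

theorem subtermAt_replaceAt {s w : L.Term V} {p : List ℕ} (h : subtermAt s p = some w)
    (t : L.Term V) : subtermAt (replaceAt s p t) p = some t := by
  induction p generalizing s with
  | nil => rw [replaceAt_nil, subtermAt_nil]
  | cons i p ih =>
    obtain ⟨n, f, ts, j, rfl, rfl, h₀⟩ := subtermAt_cons_eq_some h
    rw [replaceAt_func, subtermAt_func, Function.update_self, ih h₀]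

theorem replaceAt_replaceAt {s w : L.Term V} {p : List ℕ} (h : subtermAt s p = some w)
    (t u : L.Term V) : replaceAt (replaceAt s p t) p u = replaceAt s p u := by
  induction p generalizing s with
  | nil => simp only [replaceAt_nil]
  | cons i p ih =>
    obtain ⟨n, f, ts, j, rfl, rfl, h₀⟩ := subtermAt_cons_eq_some h
    rw [replaceAt_func, replaceAt_func, replaceAt_func, Function.update_self, ih h₀,
      Function.update_idem]

theorem replaceAt_self {s w : L.Term V} {p : List ℕ} (h : subtermAt s p = some w) :
    replaceAt s p w = s := by
  induction p generalizing s with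
  | nil =>
    rw [subtermAt_nil, Option.some.injEq] at h
    rw [replaceAt_nil, h]
  | cons i p ih =>
    obtain ⟨n, f, ts, j, rfl, rfl, h₀⟩ := subtermAt_cons_eq_some h
    rw [replaceAt_func, ih h₀, Function.update_eq_self]

theorem subtermAt_subst {s w : L.Term V} {p : List ℕ} (h : subtermAt s p = some w)
    (σ : V → L.Term V) : subtermAt (s.subst σ) p = some (w.subst σ) := by
  induction p generalizing s with
  | nil =>
    rw [subtermAt_nil, Option.some.injEq] at h
    rw [subtermAt_nil, h]
  | cons i p ih =>
    obtain ⟨n, f, ts, j, rfl, rfl, h₀⟩ := subtermAt_cons_eq_some h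
    rw [subst_func, subtermAt_func, ih h₀]

theorem replaceAt_subst {s w : L.Term V} {p : List ℕ} (h : subtermAt s p = some w) (t : L.Term V)
    (σ : V → L.Term V) : (replaceAt s p t).subst σ = replaceAt (s.subst σ) p (t.subst σ) := by
  induction p generalizing s with
  | nil => simp only [replaceAt_nil]
  | cons i p ih =>
    obtain ⟨n, f, ts, j, rfl, rfl, h₀⟩ := subtermAt_cons_eq_some h
    rw [replaceAt_func, subst_func, subst_func, replaceAt_func, ← ih h₀]
    congr 1
    funext k
    by_cases hk : k = j
    · subst hk; simp
    · simp [Function.update_of_ne hk]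

/-- A position of an instance `s.subst σ` is a function position of `s` or lies at or below a
variable position of `s`. -/
theorem subtermAt_subst_cases {s w : L.Term V} {p : List ℕ} {σ : V → L.Term V}
    (h : subtermAt (s.subst σ) p = some w) :
    (∃ (n : ℕ) (f : L.Functions n) (ts : Fin n → L.Term V), subtermAt s p = some (.func f ts)) ∨
      ∃ p₁ p₂ x, p = p₁ ++ p₂ ∧ subtermAt s p₁ = some (.var x) ∧ subtermAt (σ x) p₂ = some w := by
  induction p generalizing s with
  | nil =>
    cases s with
    | var x => exact Or.inr ⟨[], [], x, rfl, rfl, h⟩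
    | func f ts => exact Or.inl ⟨_, f, ts, rfl⟩
  | cons i p ih =>
    cases s with
    | var x => exact Or.inr ⟨[], i :: p, x, rfl, rfl, h⟩
    | func f ts =>
      obtain ⟨n, g, us, j, he, rfl, h⟩ := subtermAt_cons_eq_some h
      rw [subst_func] at he
      cases he
      rcases ih h with ⟨m, g, us, hs⟩ | ⟨p₁, p₂, x, rfl, h₁, h₂⟩
      · exact Or.inl ⟨m, g, us, by rw [subtermAt_func, hs]⟩
      · exact Or.inr ⟨j :: p₁, p₂, x, rfl, by rw [subtermAt_func, h₁], h₂⟩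

/-- The first alternative includes `p = q`, so the second one is strict; in the third, the positions
are parallel and branch after the common prefix `c`. -/
theorem position_cases (p q : List ℕ) :
    (∃ p', p = q ++ p') ∨ (∃ q', q' ≠ [] ∧ q = p ++ q') ∨
      ∃ c i j p' q', i ≠ j ∧ p = c ++ i :: p' ∧ q = c ++ j :: q' := by
  induction p generalizing q with
  | nil =>
    cases q with
    | nil => exact Or.inl ⟨[], rfl⟩
    | cons j q => exact Or.inr (Or.inl ⟨j :: q, by simp, rfl⟩)
  | cons i p ih =>
    cases q with
    | nil => exact Or.inl ⟨i :: p, rfl⟩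
    | cons j q =>
      by_cases hij : i = j
      · subst hij
        rcases ih q with ⟨p', rfl⟩ | ⟨q', hq, rfl⟩ | ⟨c, a, b, p', q', hab, rfl, rfl⟩
        · exact Or.inl ⟨p', rfl⟩
        · exact Or.inr (Or.inl ⟨q', hq, rfl⟩)
        · exact Or.inr (Or.inr ⟨i :: c, a, b, p', q', hab, rfl, rfl⟩)
      · exact Or.inr (Or.inr ⟨[], i, j, p, q, hij, rfl, rfl⟩)

theorem subtermAt_replaceAt_parallel {s v w : L.Term V} {c p q : List ℕ} {i j : ℕ} (hij : i ≠ j)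
    (hp : subtermAt s (c ++ i :: p) = some v) (hq : subtermAt s (c ++ j :: q) = some w)
    (t : L.Term V) : subtermAt (replaceAt s (c ++ i :: p) t) (c ++ j :: q) = some w := by
  induction c generalizing s with
  | nil =>
    obtain ⟨n, f, ts, k, rfl, rfl, hp₀⟩ := subtermAt_cons_eq_some hp
    obtain ⟨_, _, _, l, he, rfl, hq⟩ := subtermAt_cons_eq_some hq
    cases he
    rw [List.nil_append, List.nil_append, replaceAt_func, subtermAt_func,
      Function.update_of_ne (fun h => hij (by rw [h])), hq]
  | cons a c ih =>
    obtain ⟨n, f, ts, k, rfl, rfl, hp₀⟩ := subtermAt_cons_eq_some hp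
    rw [List.cons_append, subtermAt_func] at hq
    rw [List.cons_append, List.cons_append, replaceAt_func, subtermAt_func, Function.update_self,
      ih hp₀ hq]

theorem replaceAt_parallel_comm {s v w : L.Term V} {c p q : List ℕ} {i j : ℕ} (hij : i ≠ j)
    (hp : subtermAt s (c ++ i :: p) = some v) (hq : subtermAt s (c ++ j :: q) = some w)
    (t u : L.Term V) :
    replaceAt (replaceAt s (c ++ i :: p) t) (c ++ j :: q) u =
      replaceAt (replaceAt s (c ++ j :: q) u) (c ++ i :: p) t := by
  induction c generalizing s with
  | nil =>
    obtain ⟨n, f, ts, k, rfl, rfl, hp₀⟩ := subtermAt_cons_eq_some hp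
    obtain ⟨_, _, _, l, he, rfl, hq⟩ := subtermAt_cons_eq_some hq
    cases he
    have hkl : k ≠ l := fun h => hij (by rw [h])
    simp only [List.nil_append, replaceAt_func, Function.update_of_ne hkl,
      Function.update_of_ne hkl.symm]
    rw [Function.update_comm hkl]
  | cons a c ih =>
    obtain ⟨n, f, ts, k, rfl, rfl, hp₀⟩ := subtermAt_cons_eq_some hp
    rw [List.cons_append, subtermAt_func] at hq
    simp only [List.cons_append, replaceAt_func, Function.update_self, Function.update_idem]
    rw [ih hp₀ hq]

end Positions

/-! ### Closure properties of rewrite steps -/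

section Steps

variable {L : FirstOrder.Language} {V : Type*} {E : ES L V}

theorem StepAt.replaceAt {p q : List ℕ} {s w w' : L.Term V} (h : StepAt E q w w')
    (hs : subtermAt s p = some w) : StepAt E (p ++ q) s (replaceAt s p w') := by
  obtain ⟨ρ, hρ, σ, hσ, hw, rfl⟩ := h
  exact ⟨ρ, hρ, σ, hσ, by rw [subtermAt_append_of_eq hs, hw], (replaceAt_append hs _ _).symm⟩

theorem StepAt.exists_of_append {p q : List ℕ} {s t w : L.Term V} (h : StepAt E (p ++ q) s t)
    (hs : subtermAt s p = some w) : ∃ w', StepAt E q w w' ∧ t = TermRewriting.replaceAt s p w' := by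
  obtain ⟨ρ, hρ, σ, hσ, hw, rfl⟩ := h
  rw [subtermAt_append_of_eq hs] at hw
  exact ⟨_, ⟨ρ, hρ, σ, hσ, hw, rfl⟩, replaceAt_append hs _ _⟩

theorem StepAt.subst {p : List ℕ} {s t : L.Term V} (h : StepAt E p s t) {τ : V → L.Term V}
    (hτ : IsSubstitution τ) : StepAt E p (s.subst τ) (t.subst τ) := by
  obtain ⟨ρ, hρ, σ, hσ, hw, rfl⟩ := h
  refine ⟨ρ, hρ, _, hσ.comp hτ, ?_, ?_⟩
  · rw [subtermAt_subst hw, subst_subst]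
  · rw [replaceAt_subst hw, subst_subst]

theorem stepAt_nil {ρ : L.Term V × L.Term V} (hρ : ρ ∈ E) {σ : V → L.Term V}
    (hσ : IsSubstitution σ) : StepAt E [] (ρ.1.subst σ) (ρ.2.subst σ) :=
  ⟨ρ, hρ, σ, hσ, subtermAt_nil _, (replaceAt_nil _ _).symm⟩

/-- A relation on terms is closed under contexts. -/
def ClosedUnderContexts (r : L.Term V → L.Term V → Prop) : Prop :=
  ∀ s p w a b, subtermAt s p = some w → r a b → r (replaceAt s p a) (replaceAt s p b)

/-- A relation on terms is closed under substitutions. -/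
def ClosedUnderSubst (r : L.Term V → L.Term V → Prop) : Prop :=
  ∀ σ a b, IsSubstitution σ → r a b → r (a.subst σ) (b.subst σ)

theorem closedUnderContexts_step : ClosedUnderContexts (Step E) := by
  rintro s p w a b hs ⟨q, h⟩
  refine ⟨p ++ q, ?_⟩
  have := h.replaceAt (subtermAt_replaceAt hs a)
  rwa [replaceAt_replaceAt hs] at this

theorem closedUnderSubst_step : ClosedUnderSubst (Step E) :=
  fun _ _ _ hσ ⟨q, h⟩ => ⟨q, h.subst hσ⟩

section

variable {r : L.Term V → L.Term V → Prop}

theorem ClosedUnderContexts.reflTransGen (h : ClosedUnderContexts r) :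
    ClosedUnderContexts (Relation.ReflTransGen r) :=
  fun s p w _ _ hs hab => Relation.ReflTransGen.lift (fun a => replaceAt s p a)
    (fun _ _ hab => h s p w _ _ hs hab) _ _ hab

theorem ClosedUnderContexts.symmGen (h : ClosedUnderContexts r) :
    ClosedUnderContexts (Relation.SymmGen r) :=
  fun s p w _ _ hs hab => hab.imp (h s p w _ _ hs) (h s p w _ _ hs)

theorem ClosedUnderSubst.reflTransGen (h : ClosedUnderSubst r) :
    ClosedUnderSubst (Relation.ReflTransGen r) :=
  fun σ _ _ hσ hab => Relation.ReflTransGen.lift (fun a => a.subst σ)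
    (fun _ _ hab => h σ _ _ hσ hab) _ _ hab

theorem ClosedUnderSubst.symmGen (h : ClosedUnderSubst r) :
    ClosedUnderSubst (Relation.SymmGen r) :=
  fun σ _ _ hσ hab => hab.imp (h σ _ _ hσ) (h σ _ _ hσ)

theorem ClosedUnderContexts.valley {e : L.Term V → L.Term V → Prop} (hr : ClosedUnderContexts r)
    (he : ClosedUnderContexts e) : ClosedUnderContexts (Valley r e) :=
  fun s p w _ _ hs ⟨c, d, hac, hcd, hbd⟩ =>
    ⟨replaceAt s p c, replaceAt s p d, hr.reflTransGen s p w _ _ hs hac, he s p w _ _ hs hcd,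
      hr.reflTransGen s p w _ _ hs hbd⟩

theorem ClosedUnderSubst.valley {e : L.Term V → L.Term V → Prop} (hr : ClosedUnderSubst r)
    (he : ClosedUnderSubst e) : ClosedUnderSubst (Valley r e) :=
  fun σ _ _ hσ ⟨c, d, hac, hcd, hbd⟩ =>
    ⟨c.subst σ, d.subst σ, hr.reflTransGen σ _ _ hσ hac, he σ _ _ hσ hcd,
      hr.reflTransGen σ _ _ hσ hbd⟩

end

/-- Subterms of a normal form are normal forms. -/
theorem IsNormalForm.subtermAt {s w : L.Term V} {p : List ℕ} (h : IsNormalForm (Step E) s)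
    (hp : subtermAt s p = some w) : IsNormalForm (Step E) w :=
  fun _ ⟨q, hq⟩ => h _ ⟨p ++ q, hq.replaceAt hp⟩

theorem IsNormalForm.of_subst {s : L.Term V} {σ : V → L.Term V} (hσ : IsSubstitution σ)
    (h : IsNormalForm (Step E) (s.subst σ)) : IsNormalForm (Step E) s :=
  fun b hb => h (b.subst σ) (closedUnderSubst_step σ s b hσ hb)

/-- A step is undone at the same position with the swapped pair and the same substitution, since
replacing twice at a position keeps only the last term. -/
theorem step_symmES {B : ES L V} {a b : L.Term V} :
    Step (symmES B) a b ↔ Relation.SymmGen (Step B) a b := by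
  constructor
  · rintro ⟨p, ρ, hρ | hρ, σ, hσ, hs, rfl⟩
    · exact Or.inl ⟨p, ρ, hρ, σ, hσ, hs, rfl⟩
    · refine Or.inr ⟨p, ρ.swap, hρ, σ, hσ, subtermAt_replaceAt hs _, ?_⟩
      rw [replaceAt_replaceAt hs, Prod.snd_swap, replaceAt_self hs]
  · rintro (⟨p, ρ, hρ, σ, hσ, hs, rfl⟩ | ⟨p, ρ, hρ, σ, hσ, hs, rfl⟩)
    · exact ⟨p, ρ, Or.inl hρ, σ, hσ, hs, rfl⟩
    · refine ⟨p, ρ.swap, Or.inr ?_, σ, hσ, subtermAt_replaceAt hs _, ?_⟩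
      · simpa using hρ
      · rw [replaceAt_replaceAt hs, Prod.snd_swap, replaceAt_self hs]

end Steps

/-! ### Rewriting inside the substitution part of an instance -/

section VariableOverlap

variable {L : FirstOrder.Language} {V : Type*} {r : L.Term V → L.Term V → Prop}

/-- Reductions in all arguments of a function symbol. -/
theorem ClosedUnderContexts.func (hr : ClosedUnderContexts r) {n : ℕ} (f : L.Functions n)
    (ts us : Fin n → L.Term V) (h : ∀ i, ReflTransGen r (ts i) (us i)) :
    ReflTransGen r (.func f ts) (.func f us) := by
  classical
  -- The arguments are reduced one at a time; `S` collects those already treated.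
  have key : ∀ S : Finset (Fin n),
      ReflTransGen r (.func f ts) (.func f fun i => if i ∈ S then us i else ts i) := by
    intro S
    induction S using Finset.induction_on with
    | empty => simpa using ReflTransGen.refl
    | insert a S ha ih =>
      refine ih.trans ?_
      have := hr.reflTransGen (.func f fun i => if i ∈ S then us i else ts i) [(a : ℕ)] (ts a)
        (ts a) (us a) (by rw [subtermAt_func, subtermAt_nil, if_neg ha]) (h a)
      rw [replaceAt_func, replaceAt_func, replaceAt_nil, replaceAt_nil] at this
      convert this using 2
      · funext k
        by_cases hk : k = a
        · subst hk; simp [ha]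
        · simp [Function.update_of_ne hk]
      · funext k
        by_cases hk : k = a
        · subst hk; simp
        · simp [hk]
  simpa using key Finset.univ

variable [DecidableEq V]

theorem ClosedUnderContexts.subst_update (hr : ClosedUnderContexts r) {σ : V → L.Term V} {x : V}
    {v : L.Term V} (h : ReflTransGen r (σ x) v) (t : L.Term V) :
    ReflTransGen r (t.subst σ) (t.subst (Function.update σ x v)) := by
  induction t with
  | var y =>
    simp only [subst_var]
    by_cases hy : y = x
    · subst hy; simpa using h
    · rw [Function.update_of_ne hy]
  | func f ts ih => exact hr.func f _ _ ih

/-- After one copy of `σ x` has become `v`, the remaining copies catch up. -/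
theorem ClosedUnderContexts.replaceAt_subst_update (hr : ClosedUnderContexts r)
    {σ : V → L.Term V} {x : V} {v : L.Term V} (h : ReflTransGen r (σ x) v) {t : L.Term V}
    {p : List ℕ} (hp : subtermAt t p = some (.var x)) :
    ReflTransGen r (replaceAt (t.subst σ) p v) (t.subst (Function.update σ x v)) := by
  induction p generalizing t with
  | nil =>
    rw [subtermAt_nil, Option.some.injEq] at hp
    subst hp
    simp only [replaceAt_nil, subst_var, Function.update_self]
    exact ReflTransGen.refl
  | cons i p ih =>
    obtain ⟨n, f, ts, j, rfl, rfl, hp₀⟩ := subtermAt_cons_eq_some hp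
    rw [subst_func, replaceAt_func, subst_func]
    refine hr.func f _ _ fun k => ?_
    by_cases hk : k = j
    · subst hk
      rw [Function.update_self]
      exact ih hp₀
    · rw [Function.update_of_ne hk]
      exact hr.subst_update h _

/-- By linearity there is no other copy of `x` to catch up, so equality replaces reduction. -/
theorem replaceAt_subst_of_isLinear {σ : V → L.Term V} {x : V} {v t : L.Term V} {p : List ℕ}
    (hp : subtermAt t p = some (.var x)) (ht : IsLinear t) :
    replaceAt (t.subst σ) p v = t.subst (Function.update σ x v) := by
  induction p generalizing t with
  | nil =>
    rw [subtermAt_nil, Option.some.injEq] at hp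
    subst hp
    rw [replaceAt_nil, subst_var, Function.update_self]
  | cons i p ih =>
    obtain ⟨n, f, ts, j, rfl, rfl, hp₀⟩ := subtermAt_cons_eq_some hp
    rw [subst_func, replaceAt_func, subst_func]
    congr 1
    funext k
    by_cases hk : k = j
    · subst hk
      rw [Function.update_self]
      refine ih hp₀ fun y a b ha hb => ?_
      simpa using ht y (k :: a) (k :: b) (by rwa [subtermAt_func]) (by rwa [subtermAt_func])
    · rw [Function.update_of_ne hk]
      refine subst_eq_subst_iff.2 fun y hy => ?_
      obtain ⟨q, hq⟩ := exists_subtermAt_of_mem_vars hy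
      rw [Function.update_of_ne]
      rintro rfl
      have := ht y (j :: p) (k :: q) (by rwa [subtermAt_func]) (by rwa [subtermAt_func])
      simp only [List.cons.injEq, Fin.val_inj] at this
      exact hk this.1.symm

end VariableOverlap

/-! ### Existence of most general unifiers -/

section Unification

variable {L : FirstOrder.Language} {V : Type*}

/-- The number of symbols of a term. -/
def symbolCount : L.Term V → ℕ
  | .var _ => 1
  | .func _ ts => 1 + ∑ i, symbolCount (ts i)

theorem symbolCount_le_subst {t : L.Term V} {x : V} (hx : x ∈ vars t) (σ : V → L.Term V) :
    symbolCount (σ x) ≤ symbolCount (t.subst σ) := by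
  induction t with
  | var y => rw [mem_vars_var.1 hx, subst_var]
  | func f ts ih =>
    obtain ⟨i, hi⟩ := mem_vars_func.1 hx
    have := Finset.single_le_sum (f := fun i => symbolCount ((ts i).subst σ))
      (fun _ _ => Nat.zero_le _) (Finset.mem_univ i)
    have := ih i hi
    simp only [subst_func, symbolCount]
    omega

/-- A proper instance containing `x` cannot be unified with `x`. -/
theorem eq_var_of_unifier {t : L.Term V} {x : V} (hx : x ∈ vars t) {σ : V → L.Term V}
    (h : σ x = t.subst σ) : t = .var x := by
  cases t with
  | var y => rw [mem_vars_var.1 hx]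
  | func f ts =>
    exfalso
    obtain ⟨i, hi⟩ := mem_vars_func.1 hx
    have h1 := symbolCount_le_subst hi σ
    have h2 := Finset.single_le_sum (f := fun i => symbolCount ((ts i).subst σ))
      (fun _ _ => Nat.zero_le _) (Finset.mem_univ i)
    have h3 := congrArg symbolCount h
    simp only [subst_func, symbolCount] at h3
    omega

/-- `σ` solves all equations of a list. -/
def Solves (σ : V → L.Term V) (E : List (L.Term V × L.Term V)) : Prop :=
  ∀ e ∈ E, e.1.subst σ = e.2.subst σ

/-- `μ` is an idempotent most general solution of a list of equations. -/
def IsPrincipalSolution (μ : V → L.Term V) (E : List (L.Term V × L.Term V)) : Prop :=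
  IsSubstitution μ ∧ Solves μ E ∧ ∀ τ, Solves τ E → ∀ x, τ x = (μ x).subst τ

theorem solves_cons {σ : V → L.Term V} {e : L.Term V × L.Term V}
    {E : List (L.Term V × L.Term V)} :
    Solves σ (e :: E) ↔ e.1.subst σ = e.2.subst σ ∧ Solves σ E := by
  simp [Solves]

/-- The total number of symbols of a list of equations. -/
def equationsSize (E : List (L.Term V × L.Term V)) : ℕ :=
  (E.map fun e => symbolCount e.1 + symbolCount e.2).sum

/-- Applying a substitution to all equations of a list. -/
def substEquations (σ : V → L.Term V) (E : List (L.Term V × L.Term V)) :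
    List (L.Term V × L.Term V) := E.map fun e => (e.1.subst σ, e.2.subst σ)

theorem solves_substEquations {σ τ : V → L.Term V} {E : List (L.Term V × L.Term V)} :
    Solves τ (substEquations σ E) ↔ Solves (fun x => (σ x).subst τ) E := by
  simp only [Solves, substEquations, List.forall_mem_map, subst_subst]

theorem update_var_subst [DecidableEq V] {τ : V → L.Term V} {x : V} {t : L.Term V}
    (h : τ x = t.subst τ) (y : V) : (Function.update Term.var x t y).subst τ = τ y := by
  by_cases hy : y = x
  · subst hy; rw [Function.update_self, h]
  · rw [Function.update_of_ne hy, subst_var]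

/-- Any solution `τ` of `x ≈ t` absorbs the substitution `x ↦ t`, so it also solves the remaining
equations after elimination and factors through `μ`. -/
theorem IsPrincipalSolution.eliminate [DecidableEq V] {μ : V → L.Term V} {x : V} {t : L.Term V}
    (hx : x ∉ vars t) {E : List (L.Term V × L.Term V)}
    (h : IsPrincipalSolution μ (substEquations (Function.update Term.var x t) E)) :
    IsPrincipalSolution (fun y => (Function.update Term.var x t y).subst μ)
      ((.var x, t) :: E) := by
  obtain ⟨hμ, hs, hp⟩ := h
  refine ⟨(isSubstitution_var.update x t).comp hμ,
    solves_cons.2 ⟨?_, solves_substEquations.1 hs⟩, fun τ hτ y => ?_⟩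
  · simp only [subst_var, Function.update_self]
    refine subst_eq_subst_iff.2 fun y hy => ?_
    rw [Function.update_of_ne (ne_of_mem_of_not_mem hy hx), subst_var]
  · obtain ⟨h1, h2⟩ := solves_cons.1 hτ
    have hτ' : (fun y => (Function.update Term.var x t y).subst τ) = τ :=
      funext (update_var_subst h1)
    have h3 := hp τ (solves_substEquations.2 (by rwa [hτ']))
    rw [subst_subst]
    conv_lhs => rw [← update_var_subst h1 y]
    exact subst_eq_subst_iff.2 fun z _ => h3 z

theorem IsPrincipalSolution.congr {μ : V → L.Term V} {E F : List (L.Term V × L.Term V)}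
    (h : ∀ σ, Solves σ E ↔ Solves σ F) (hμ : IsPrincipalSolution μ E) :
    IsPrincipalSolution μ F :=
  ⟨hμ.1, (h μ).1 hμ.2.1, fun τ hτ => hμ.2.2 τ ((h τ).2 hτ)⟩

theorem vars_subst_update_var [DecidableEq V] {X : Finset V} {x : V} {t u : L.Term V}
    (hxt : x ∉ vars t) (ht : vars t ⊆ X) (hu : vars u ⊆ X) :
    vars (u.subst (Function.update Term.var x t)) ⊆ X.erase x := by
  intro y hy
  obtain ⟨z, hz, hy⟩ := mem_vars_subst.1 hy
  by_cases hzx : z = x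
  · subst hzx
    rw [Function.update_self] at hy
    exact Finset.mem_erase.2 ⟨fun h => hxt (h ▸ hy), ht hy⟩
  · rw [Function.update_of_ne hzx, mem_vars_var] at hy
    subst hy
    exact Finset.mem_erase.2 ⟨hzx, hu hz⟩

/-- Solvable finite lists of equations have idempotent most general solutions. -/
theorem exists_isPrincipalSolution (X : Finset V) (E : List (L.Term V × L.Term V))
    (hX : ∀ e ∈ E, vars e.1 ⊆ X ∧ vars e.2 ⊆ X) (hE : ∃ τ, Solves τ E) :
    ∃ μ, IsPrincipalSolution μ E := by
  classical
  induction hn : X.card using Nat.strong_induction_on generalizing X E with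
  | _ n ihX =>
  induction hm : equationsSize E using Nat.strong_induction_on generalizing E with
  | _ m ihE =>
  obtain ⟨τ, hτ⟩ := hE
  match E with
  | [] => exact ⟨Term.var, isSubstitution_var, by simp [Solves], fun τ _ x => rfl⟩
  | (a, b) :: E =>
    obtain ⟨⟨ha, hb⟩, hXE⟩ := List.forall_mem_cons.1 hX
    obtain ⟨hab, hτE⟩ := solves_cons.1 hτ
    dsimp only at ha hb hab
    -- Solvability forces `t = x` if `x` occurs in `t`, and the equation is dropped; otherwise
    -- eliminating `x` shrinks `X`, which dominates any growth in size.
    have elim : ∀ x t, vars (Term.var x : L.Term V) ⊆ X → vars t ⊆ X → τ x = t.subst τ →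
        symbolCount t < m - equationsSize E →
        ∃ μ, IsPrincipalSolution μ ((.var x, t) :: E) := by
      intro x t hx ht hxt hlt
      by_cases hxv : x ∈ vars t
      · obtain rfl := eq_var_of_unifier hxv hxt
        obtain ⟨μ, hμ⟩ := ihE (equationsSize E) (by omega) E hXE ⟨τ, hτE⟩ rfl
        exact ⟨μ, hμ.congr fun σ => by simp [solves_cons]⟩
      · have hxX : x ∈ X := hx (mem_vars_var.2 rfl)
        obtain ⟨μ, hμ⟩ := ihX (X.erase x).card
          (hn ▸ Finset.card_erase_lt_of_mem hxX) (X.erase x)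
          (substEquations (Function.update Term.var x t) E)
          (by
            intro e he
            obtain ⟨e', he', rfl⟩ := List.mem_map.1 he
            exact ⟨vars_subst_update_var hxv ht (hXE e' he').1,
              vars_subst_update_var hxv ht (hXE e' he').2⟩)
          ⟨τ, solves_substEquations.2 (by rwa [funext (update_var_subst hxt)])⟩ rfl
        exact ⟨_, hμ.eliminate hxv⟩
    have hsize : m = symbolCount a + symbolCount b + equationsSize E := by
      rw [← hm]; simp [equationsSize]
    match a, b with
    | .var x, t =>
      refine elim x t ha hb hab ?_
      simp only [symbolCount] at hsize
      omega
    | .func f ts, .var x =>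
      obtain ⟨μ, hμ⟩ := elim x (.func f ts) hb ha hab.symm (by
        rw [hsize, symbolCount.eq_1 x]
        omega)
      exact ⟨μ, hμ.congr fun σ => by simp [solves_cons, eq_comm]⟩
    | .func (l := k) f ts, .func g us =>
      simp only [subst_func, Term.func.injEq] at hab
      obtain ⟨rfl, hfg, hts⟩ := hab
      rw [heq_eq_eq] at hfg hts
      subst hfg
      -- Decomposition removes the two root symbols, so the size decreases while `X` stays fixed.
      have hsolves : ∀ σ : V → L.Term V, Solves σ (List.ofFn (fun i => (ts i, us i)) ++ E) ↔
          Solves σ ((.func f ts, .func f us) :: E) := by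
        intro σ
        rw [solves_cons, subst_func, subst_func, Term.func.injEq, heq_eq_eq, heq_eq_eq]
        simp only [Solves, List.forall_mem_append, List.forall_mem_ofFn_iff, true_and, funext_iff]
      obtain ⟨μ, hμ⟩ := ihE (equationsSize (List.ofFn (fun i => (ts i, us i)) ++ E))
        (by
          rw [hsize]
          simp only [equationsSize, List.map_append, List.sum_append, List.map_ofFn,
            List.sum_ofFn, Function.comp_apply, Finset.sum_add_distrib, symbolCount]
          omega)
        (List.ofFn (fun i => (ts i, us i)) ++ E)
        (by
          rw [List.forall_mem_append, List.forall_mem_ofFn_iff]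
          exact ⟨fun i => ⟨fun x hx => ha (mem_vars_func.2 ⟨i, hx⟩),
            fun x hx => hb (mem_vars_func.2 ⟨i, hx⟩)⟩, hXE⟩)
        ⟨τ, (hsolves τ).2 (solves_cons.2 ⟨by simp only [subst_func, hts], hτE⟩)⟩ rfl
      exact ⟨μ, hμ.congr hsolves⟩

/-- Unifiable terms have a most general unifier. -/
theorem exists_isMGU {s t : L.Term V} {τ : V → L.Term V} (h : s.subst τ = t.subst τ) :
    ∃ μ, IsMGU μ s t ∧ ∀ x, τ x = (μ x).subst τ := by
  classical
  obtain ⟨μ, hμ, hs, hp⟩ := exists_isPrincipalSolution (vars s ∪ vars t) [(s, t)]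
    (by simp) ⟨τ, by simpa [Solves] using h⟩
  exact ⟨μ, ⟨⟨hμ, by simpa [Solves] using hs⟩,
    fun ρ hρ => ⟨ρ, hρ.1, hp ρ (by simpa [Solves] using hρ.2)⟩⟩,
    hp τ (by simpa [Solves] using h)⟩

end Unification

/-! ### Renaming variables apart -/

section Renamings

variable {L : FirstOrder.Language} {V : Type*}

theorem exists_perm_disjoint [Infinite V] (X Y : Finset V) :
    ∃ π : Equiv.Perm V, {x | π x ≠ x}.Finite ∧ ∀ x ∈ X, π x ∉ Y := by
  classical
  induction X using Finset.induction_on with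
  | empty => exact ⟨1, by simp, by simp⟩
  | insert a X ha ih =>
    obtain ⟨π, hfin, hπ⟩ := ih
    obtain ⟨z, hz⟩ := Infinite.exists_notMem_finset (Y ∪ X.image π)
    rw [Finset.mem_union, not_or] at hz
    -- The swap redirects `a` to the fresh `z` and leaves the images of `X` alone, as these avoid
    -- both `π a` and `z`.
    refine ⟨Equiv.swap (π a) z * π, ?_, ?_⟩
    · refine (hfin.union (Set.toFinite {π a, z})).subset fun x hx => ?_
      by_contra h
      simp only [Set.mem_union, Set.mem_ofPred_eq, Set.mem_insert_iff, Set.mem_singleton_iff,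
        not_or, not_not] at h
      refine hx ?_
      rw [Equiv.Perm.mul_apply, h.1, Equiv.swap_apply_of_ne_of_ne h.2.1 h.2.2]
    · intro x hx
      rw [Equiv.Perm.mul_apply]
      rcases Finset.mem_insert.1 hx with rfl | hx
      · rw [Equiv.swap_apply_left]
        exact hz.1
      · rw [Equiv.swap_apply_of_ne_of_ne]
        · exact hπ x hx
        · exact fun h => ha (π.injective h ▸ hx)
        · exact fun h => hz.2 (h ▸ Finset.mem_image_of_mem π hx)

theorem isRenaming_var_comp {π : Equiv.Perm V} (h : {x | π x ≠ x}.Finite) :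
    IsRenaming fun x => (Term.var (π x) : L.Term V) :=
  ⟨h.subset fun _ hx hπ => hx (congrArg Term.var hπ), π, fun _ => rfl⟩

theorem isVariant_refl (ρ : L.Term V × L.Term V) : IsVariant ρ ρ :=
  ⟨Term.var, ⟨isSubstitution_var, 1, fun _ => rfl⟩, subst_id _, subst_id _⟩

theorem IsSubstitution.ite {σ τ : V → L.Term V} (hσ : IsSubstitution σ) (hτ : IsSubstitution τ)
    (p : V → Prop) [DecidablePred p] : IsSubstitution fun x => if p x then σ x else τ x := by
  refine (hσ.union hτ).subset fun x hx => ?_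
  by_cases h : p x
  · exact Or.inl (by simpa [h] using hx)
  · exact Or.inr (by simpa [h] using hx)

end Renamings

/-! ### Innermost steps and prime critical pairs -/

section PrimeCriticalPairs

variable {L : FirstOrder.Language} {V : Type*} {R E E₁ E₂ : ES L V}

theorem IsPrimePeak.of_subst {p : List ℕ} {s : L.Term V} {τ : V → L.Term V}
    (hτ : IsSubstitution τ) (h : IsPrimePeak R p (s.subst τ)) : IsPrimePeak R p s :=
  fun _ hw q _ hq hv => IsNormalForm.of_subst hτ
    (h _ (subtermAt_subst hw τ) q _ hq (subtermAt_subst hv τ))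

theorem IsPrimePeak.append {p q : List ℕ} {s : L.Term V} (h : IsPrimePeak R p s) :
    IsPrimePeak R (p ++ q) s := by
  intro w hw q' v hq' hv
  rw [subtermAt_append, Option.bind_eq_some_iff] at hw
  obtain ⟨u, hu, hw⟩ := hw
  exact h u hu (q ++ q') v (by simp [hq']) (by rw [subtermAt_append_of_eq hw, hv])

theorem isPrimePeak_append_iff {p q : List ℕ} {s w : L.Term V} (h : subtermAt s p = some w) :
    IsPrimePeak R (p ++ q) s ↔ IsPrimePeak R q w := by
  simp only [IsPrimePeak, subtermAt_append_of_eq h]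

/-- A reducible term admits an innermost step. -/
theorem exists_innermost_step {s t : L.Term V} (h : Step R s t) :
    ∃ p u, StepAt R p s u ∧ IsPrimePeak R p s := by
  induction s generalizing t with
  | var x =>
    obtain ⟨p, hp⟩ := h
    refine ⟨p, t, hp, fun w hw q v hq hv => ?_⟩
    cases p with
    | nil =>
      cases q with
      | nil => exact absurd rfl hq
      | cons i q =>
        rw [subtermAt_nil, Option.some.injEq] at hw
        subst hw
        simp [subtermAt] at hv
    | cons i p => simp [subtermAt] at hw
  | func f ts ih =>
    by_cases hred : ∃ i u, Step R (ts i) u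
    · obtain ⟨i, u, hu⟩ := hred
      obtain ⟨p, v, hv, hp⟩ := ih i hu
      have hi : subtermAt (.func f ts) [(i : ℕ)] = some (ts i) := by
        rw [subtermAt_func, subtermAt_nil]
      exact ⟨[(i : ℕ)] ++ p, _, hv.replaceAt hi, (isPrimePeak_append_iff hi).2 hp⟩
    -- All arguments are normal forms, hence so are all proper subterms; any step is innermost.
    · push Not at hred
      obtain ⟨p, hp⟩ := h
      refine ⟨p, t, hp, fun w hw q v hq hv => ?_⟩
      cases hpq : p ++ q with
      | nil => exact absurd (List.append_eq_nil_iff.1 hpq).2 hq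
      | cons i p' =>
        rw [← subtermAt_append_of_eq hw, hpq] at hv
        obtain ⟨n, g, us, j, he, rfl, hv⟩ := subtermAt_cons_eq_some hv
        cases he
        exact IsNormalForm.subtermAt (hred j) hv

/-- Function-position overlaps of instances are instances of prime critical pairs, or trivial. -/
theorem exists_mem_primeCPs [Infinite V] {ρ₁ ρ₂ : L.Term V × L.Term V} (h₁ : ρ₁ ∈ E₁)
    (h₂ : ρ₂ ∈ E₂) (hvars : vars ρ₁.2 ⊆ vars ρ₁.1) {σ₁ σ₂ : V → L.Term V}
    (hσ₁ : IsSubstitution σ₁) (hσ₂ : IsSubstitution σ₂) {p : List ℕ} {n : ℕ} {f : L.Functions n}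
    {ts : Fin n → L.Term V} (hp : subtermAt ρ₂.1 p = some (.func f ts))
    (heq : subtermAt (ρ₂.1.subst σ₂) p = some (ρ₁.1.subst σ₁))
    (hprime : IsPrimePeak R p (ρ₂.1.subst σ₂)) :
    replaceAt (ρ₂.1.subst σ₂) p (ρ₁.2.subst σ₁) = ρ₂.2.subst σ₂ ∨
      ∃ e ∈ primeCPs R E₁ E₂, ∃ τ, IsSubstitution τ ∧
        e.1.subst τ = replaceAt (ρ₂.1.subst σ₂) p (ρ₁.2.subst σ₁) ∧
        e.2.subst τ = ρ₂.2.subst σ₂ := by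
  classical
  obtain ⟨π, hπ, hdisj⟩ := exists_perm_disjoint (vars ρ₁.1) (vars ρ₂.1 ∪ vars ρ₂.2)
  have hπ' : {x | π.symm x ≠ x}.Finite := hπ.subset fun x hx h =>
    hx (by rw [Equiv.symm_apply_eq, h])
  set ν : V → L.Term V := fun x => .var (π x) with hν
  -- With the variables renamed apart, `σ₁` and `σ₂` merge into a single unifier `τ`.
  obtain ⟨τ, hτdef⟩ : ∃ τ : V → L.Term V, τ = fun x => if x ∈ vars ρ₂.1 ∪ vars ρ₂.2 then σ₂ x
    else ((.var (π.symm x) : L.Term V)).subst σ₁ := ⟨_, rfl⟩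
  have hτ : IsSubstitution τ :=
    hτdef ▸ hσ₂.ite ((isRenaming_var_comp (L := L) hπ').1.comp hσ₁) _
  have hτ₁ : ∀ t : L.Term V, vars t ⊆ vars ρ₁.1 → (t.subst ν).subst τ = t.subst σ₁ := by
    intro t ht
    rw [subst_subst]
    refine subst_eq_subst_iff.2 fun x hx => ?_
    simp only [hν, subst_var, hτdef, if_neg (hdisj x (ht hx)), Equiv.symm_apply_apply]
  have hτ₂ : ∀ t : L.Term V, vars t ⊆ vars ρ₂.1 ∪ vars ρ₂.2 → t.subst τ = t.subst σ₂ := by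
    intro t ht
    refine subst_eq_subst_iff.2 fun x hx => ?_
    simp only [hτdef, if_pos (ht hx)]
  have hl := hτ₁ ρ₁.1 subset_rfl
  have hr := hτ₁ ρ₁.2 hvars
  have hl₂ := hτ₂ ρ₂.1 Finset.subset_union_left
  have hr₂ := hτ₂ ρ₂.2 Finset.subset_union_right
  have hunif : (ρ₁.1.subst ν).subst τ = (Term.func f ts).subst τ := by
    have := subtermAt_subst hp τ
    rw [hl₂, heq, Option.some.injEq] at this
    rw [hl, this]
  -- Variants at the root are excluded from overlaps; there the left-hand sides agree under `τ`, and
  -- so do the right-hand sides, which have no extra variables.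
  by_cases hvar : p = [] ∧ IsVariant (ρ₁.1.subst ν, ρ₁.2.subst ν) ρ₂
  · left
    obtain ⟨rfl, θ, -, hθ₁, hθ₂⟩ := hvar
    rw [replaceAt_nil, ← hr, ← hr₂, ← hθ₂]
    have h : ((ρ₁.1.subst ν).subst θ).subst τ = (ρ₁.1.subst ν).subst τ := by
      rw [hl]
      rw [subtermAt_nil, Option.some.injEq] at heq
      rw [← heq, ← hl₂, ← hθ₁]
    simp only [subst_subst] at h ⊢
    exact subst_eq_subst_iff.2 fun x hx => (subst_eq_subst_iff.1 h x (hvars hx)).symm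
  · right
    obtain ⟨μ, hμ, hμτ⟩ := exists_isMGU hunif
    have hinst : ∀ t : L.Term V, (t.subst μ).subst τ = t.subst τ := fun t => by
      rw [subst_subst]
      exact subst_eq_subst_iff.2 fun x _ => (hμτ x).symm
    refine ⟨(replaceAt (ρ₂.1.subst μ) p ((ρ₁.2.subst ν).subst μ), ρ₂.2.subst μ),
      ⟨p, ρ₂.1.subst μ, ⟨(ρ₁.1.subst ν, ρ₁.2.subst ν), ρ₂, _, μ, ?_, hp, hμ, rfl, rfl, rfl⟩, ?_⟩,
      τ, hτ, ?_, ?_⟩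
    · refine ⟨⟨ρ₁, h₁, ν, isRenaming_var_comp hπ, rfl, rfl⟩, ⟨ρ₂, h₂, isVariant_refl ρ₂⟩, ?_,
        ⟨n, f, ts, hp, τ, hτ, hunif⟩, fun h h' => hvar ⟨h, h'⟩⟩
      intro x hx
      have hx' : ∃ y ∈ vars ρ₁.1, x = π y := by
        rcases hx with hx | hx
        · obtain ⟨y, hy, hx⟩ := mem_vars_subst.1 hx
          exact ⟨y, hy, mem_vars_var.1 hx⟩
        · obtain ⟨y, hy, hx⟩ := mem_vars_subst.1 hx
          exact ⟨y, hvars hy, mem_vars_var.1 hx⟩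
      obtain ⟨y, hy, rfl⟩ := hx'
      simpa [not_or] using hdisj y hy
    · refine IsPrimePeak.of_subst hτ ?_
      rwa [hinst, hl₂]
    · dsimp only
      rw [replaceAt_subst (subtermAt_subst hp μ), hinst, hinst, hl₂, hr]
    · dsimp only
      rw [hinst, hr₂]

/-- Critical peaks are peaks. -/
theorem IsCriticalPeak.steps {t s u : L.Term V} {p : List ℕ}
    (h : IsCriticalPeak E₁ E₂ t p s u) : Step E₁ s t ∧ Step E₂ s u := by
  obtain ⟨ρ₁, ρ₂, w, σ, hov, hw, ⟨⟨hσ, hu⟩, -⟩, rfl, rfl, rfl⟩ := h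
  obtain ⟨π₁, h₁, ν₁, hν₁, hl₁, hr₁⟩ := hov.variant_left
  obtain ⟨π₂, h₂, ν₂, hν₂, hl₂, hr₂⟩ := hov.variant_right
  constructor
  · refine ⟨p, π₁, h₁, _, hν₁.1.comp hσ, ?_, ?_⟩
    · rw [← subst_subst, hl₁, hu, subtermAt_subst hw]
    · rw [← subst_subst, hr₁]
  · refine ⟨[], π₂, h₂, _, hν₂.1.comp hσ, ?_, ?_⟩
    · rw [← subst_subst, hl₂, subtermAt_nil]
    · rw [← subst_subst, hr₂, replaceAt_nil]

end PrimeCriticalPairs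

/-! ### Closing peaks and cliffs that contain a prime step -/

section LocalPeaks

variable {L : FirstOrder.Language} {V : Type*} {R E : ES L V} {e : L.Term V → L.Term V → Prop}

theorem Valley.head_left {A : Type*} {r e : A → A → Prop} {a a' b : A}
    (h : ReflTransGen r a a') (hv : Valley r e a' b) : Valley r e a b := by
  obtain ⟨c, d, h1, h2, h3⟩ := hv
  exact ⟨c, d, h.trans h1, h2, h3⟩

theorem Valley.head_right {A : Type*} {r e : A → A → Prop} {a b b' : A}
    (h : ReflTransGen r b b') (hv : Valley r e a b') : Valley r e a b := by
  obtain ⟨c, d, h1, h2, h3⟩ := hv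
  exact ⟨c, d, h1, h2, h.trans h3⟩

theorem Valley.symm {A : Type*} {r e : A → A → Prop} (he : ∀ a b, e a b → e b a) {a b : A}
    (h : Valley r e a b) : Valley r e b a := by
  obtain ⟨c, d, h1, h2, h3⟩ := h
  exact ⟨d, c, h3, he _ _ h2, h1⟩

/-- The step acts inside one copy of `σ x`; `σ'` performs it in `σ x` itself, hence in every copy at
once. -/
theorem StepAt.of_append_var {p₁ p₂ : List ℕ} {l t : L.Term V} {x : V}
    (hx : subtermAt l p₁ = some (.var x)) {σ : V → L.Term V} (hσ : IsSubstitution σ)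
    (h : StepAt E (p₁ ++ p₂) (l.subst σ) t) :
    ∃ σ', IsSubstitution σ' ∧ (∀ u : L.Term V, ReflTransGen (Step E) (u.subst σ) (u.subst σ')) ∧
      ReflTransGen (Step E) t (l.subst σ') ∧ (IsLinear l → t = l.subst σ') := by
  classical
  obtain ⟨v, hv, rfl⟩ := h.exists_of_append (subtermAt_subst hx σ)
  have hxv : ReflTransGen (Step E) (σ x) v := ReflTransGen.single ⟨p₂, hv⟩
  exact ⟨Function.update σ x v, hσ.update x v, closedUnderContexts_step.subst_update hxv,
    closedUnderContexts_step.replaceAt_subst_update hxv hx, replaceAt_subst_of_isLinear hx⟩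

/-- A peak or cliff between a step of `R` at a prime position and a step of `E` is closed by a
valley if all prime critical pairs are. -/
theorem valley_of_primeCPs [Infinite V] (he : ∀ a, e a a) (hsymm : ∀ a b, e a b → e b a)
    (hctx : ClosedUnderContexts (Valley (Step R) e))
    (hsubst : ClosedUnderSubst (Valley (Step R) e))
    (hvalley : ∀ a b, ReflTransGen (Step E) a b → Valley (Step R) e a b)
    (hlin : IsLeftLinear R) (hR : ∀ ρ ∈ R, vars ρ.2 ⊆ vars ρ.1)
    (hE : ∀ ρ ∈ E, vars ρ.2 ⊆ vars ρ.1)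
    (hRE : ∀ c ∈ primeCPs R R E, Valley (Step R) e c.1 c.2)
    (hER : ∀ c ∈ primeCPs R E R, Valley (Step R) e c.1 c.2)
    {p q : List ℕ} {s t u : L.Term V} (ht : StepAt R p s t) (hu : StepAt E q s u)
    (hprime : IsPrimePeak R p s) : Valley (Step R) e t u := by
  have hrefl : ∀ a, Valley (Step R) e a a := fun a => ⟨a, a, .refl, he a, .refl⟩
  rcases position_cases p q with ⟨p', rfl⟩ | ⟨q', -, rfl⟩ | ⟨c, i, j, p', q', hij, rfl, rfl⟩
  · obtain ⟨ρ₂, hρ₂, σ₂, hσ₂, hs, rfl⟩ := hu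
    obtain ⟨t, ht₀, rfl⟩ := ht.exists_of_append hs
    rw [isPrimePeak_append_iff hs] at hprime
    refine hctx s q _ _ _ hs ?_
    obtain ⟨ρ₁, hρ₁, σ₁, hσ₁, heq, rfl⟩ := id ht₀
    rcases subtermAt_subst_cases heq with ⟨n, f, ts, hp⟩ | ⟨p₁, p₂, x, rfl, hx, -⟩
    · rcases exists_mem_primeCPs hρ₁ hρ₂ (hR _ hρ₁) hσ₁ hσ₂ hp heq hprime with
        h | ⟨c, hc, τ, hτ, h₁, h₂⟩
      · rw [h]
        exact hrefl _
      · rw [← h₁, ← h₂]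
        exact hsubst τ _ _ hτ (hRE c hc)
    -- The inner step is in `R`, so missing copies are supplied by further `R`-steps and no
    -- linearity of the outer pair is needed.
    · obtain ⟨σ', hσ', hred, hl, -⟩ := ht₀.of_append_var hx hσ₂
      exact .head_left hl (.head_right (hred _)
        (hvalley _ _ (.single ⟨[], stepAt_nil hρ₂ hσ'⟩)))
  · obtain ⟨ρ₂, hρ₂, σ₂, hσ₂, hs, rfl⟩ := ht
    -- The overlap now sits at the lower position of the `E`-step; primality passes to positions
    -- further down.
    replace hprime : IsPrimePeak R (p ++ q') s := hprime.append
    obtain ⟨u, hu₀, rfl⟩ := hu.exists_of_append hs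
    rw [isPrimePeak_append_iff hs] at hprime
    refine hctx s p _ _ _ hs ?_
    obtain ⟨ρ₁, hρ₁, σ₁, hσ₁, heq, rfl⟩ := id hu₀
    rcases subtermAt_subst_cases heq with ⟨n, f, ts, hp⟩ | ⟨p₁, p₂, x, rfl, hx, -⟩
    · rcases exists_mem_primeCPs hρ₁ hρ₂ (hE _ hρ₁) hσ₁ hσ₂ hp heq hprime with
        h | ⟨c, hc, τ, hτ, h₁, h₂⟩
      · rw [h]
        exact hrefl _
      · rw [← h₁, ← h₂]
        exact (hsubst τ _ _ hτ (hER c hc)).symm hsymm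
    · obtain ⟨σ', hσ', hred, -, hl⟩ := hu₀.of_append_var hx hσ₂
      -- Left-linearity makes `u` itself an instance of the left-hand side; catching up by `E`-steps
      -- before the `R`-step would not give a valley when `E` is `B^±`.
      rw [hl (hlin _ hρ₂)]
      exact .head_right (.single ⟨[], stepAt_nil hρ₂ hσ'⟩) (hvalley _ _ (hred _))
  · obtain ⟨ρ₁, hρ₁, σ₁, hσ₁, hs₁, rfl⟩ := ht
    obtain ⟨ρ₂, hρ₂, σ₂, hσ₂, hs₂, rfl⟩ := hu
    refine .head_right (.single ⟨_, ρ₁, hρ₁, σ₁, hσ₁,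
      subtermAt_replaceAt_parallel hij.symm hs₂ hs₁ _, rfl⟩) (hvalley _ _ (.single ?_))
    rw [replaceAt_parallel_comm hij.symm hs₂ hs₁]
    exact ⟨_, ρ₂, hρ₂, σ₂, hσ₂, subtermAt_replaceAt_parallel hij hs₁ hs₂ _, rfl⟩

end LocalPeaks

/-! ### Church–Rosser modulo an equivalence, abstractly -/

section AbstractChurchRosser

variable {A : Type*} {r b : A → A → Prop}

theorem TerminatingModulo.wellFounded {e : A → A → Prop} (h : TerminatingModulo r e) :
    WellFounded fun x y => RewriteModulo r e y x :=
  wellFounded_iff_isEmpty_descending_chain.2 ⟨fun f => h ⟨f.1, f.2⟩⟩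

/-- `n` is a normal form of `x`. -/
def IsNormalFormOf (r : A → A → Prop) (x n : A) : Prop := ReflTransGen r x n ∧ IsNormalForm r n

theorem IsNormalFormOf.of_reflTransGen {x y n : A} (hxy : ReflTransGen r x y)
    (h : IsNormalFormOf r y n) : IsNormalFormOf r x n := ⟨hxy.trans h.1, h.2⟩

theorem IsNormalFormOf.eq_of_isNormalForm {x n : A} (h : IsNormalFormOf r x n)
    (hx : IsNormalForm r x) : n = x := by
  rcases ReflTransGen.cases_head h.1 with h | ⟨y, hy, -⟩
  · exact h.symm
  · exact absurd hy (hx y)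

theorem IsNormalFormOf.exists_step {x n : A} (h : IsNormalFormOf r x n)
    (hx : ¬ IsNormalForm r x) : ∃ y, r x y ∧ IsNormalFormOf r y n := by
  rcases ReflTransGen.cases_head h.1 with h' | ⟨y, hy, hyn⟩
  · exact absurd (h' ▸ h.2) hx
  · exact ⟨y, hy, hyn, h.2⟩

theorem TerminatingModulo.exists_isNormalFormOf {e : A → A → Prop} (he : ∀ a, e a a)
    (h : TerminatingModulo r e) (x : A) : ∃ n, IsNormalFormOf r x n := by
  induction x using h.wellFounded.induction with
  | _ x ih =>
  by_cases hx : IsNormalForm r x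
  · exact ⟨x, .refl, hx⟩
  · simp only [IsNormalForm, not_forall, not_not] at hx
    obtain ⟨y, hy⟩ := hx
    obtain ⟨n, hn⟩ := ih y ⟨x, y, he x, hy, he y⟩
    exact ⟨n, hn.of_reflTransGen (.single hy)⟩

/-- If local peaks and local cliffs decompose into two valleys via a reduct of their source, then
equivalent elements have equivalent normal forms. -/
theorem equiv_of_isNormalFormOf (hb : ∀ x y, b x y → b y x)
    (hterm : TerminatingModulo r (ReflTransGen b))
    (hlocal : ∀ s t u, r s t → r s u ∨ b s u → ∃ v, r s v ∧
      Valley r (ReflTransGen b) t v ∧ Valley r (ReflTransGen b) v u)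
    {x y m n : A} (hxy : ReflTransGen b x y) (hm : IsNormalFormOf r x m)
    (hn : IsNormalFormOf r y n) : ReflTransGen b m n := by
  have hnf := hterm.exists_isNormalFormOf fun _ => .refl
  have hsymm : ∀ x y, ReflTransGen b x y → ReflTransGen b y x := fun x y h => by
    induction h with
    | refl => exact .refl
    | tail _ h ih => exact .head (hb _ _ h) ih
  let lt := TransGen fun x y => RewriteModulo r (ReflTransGen b) y x
  have hwf : WellFounded lt := hterm.wellFounded.transGen
  have lt_of_step : ∀ s s' x, ReflTransGen b s s' → r s' x → lt x s :=
    fun s s' x hs hx => .single ⟨s', x, hs, hx, .refl⟩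
  have lt_of_red : ∀ s x y, lt x s → ReflTransGen r x y → lt y s := by
    intro s x y hx hxy
    induction hxy with
    | refl => exact hx
    | tail _ h ih => exact .head ⟨_, _, .refl, h, .refl⟩ ih
  induction x using hwf.induction generalizing y m n with
  | _ s ih =>
  -- Only `x` must lie below `s`: the induction hypothesis is used at `x` and its reduct `c`, and
  -- the normal forms of `y` are left to the caller.
  have valley : ∀ x y m n, lt x s → Valley r (ReflTransGen b) x y →
      (∀ n', IsNormalFormOf r y n' → ReflTransGen b n' n) →
      IsNormalFormOf r x m → ReflTransGen b m n := by
    rintro x y m n hx ⟨c, d, hxc, hcd, hyd⟩ hy hm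
    obtain ⟨n₁, hn₁⟩ := hnf c
    obtain ⟨n₂, hn₂⟩ := hnf d
    exact (ih x hx .refl hm (hn₁.of_reflTransGen hxc)).trans
      ((ih c (lt_of_red s x c hx hxc) hcd hn₁ hn₂).trans (hy n₂ (hn₂.of_reflTransGen hyd)))
  -- Stated for the whole equivalence class of `s`, since `cliff` needs it at `y`, which is
  -- equivalent to `s` and need not be smaller.
  have unique : ∀ x m n, ReflTransGen b s x → IsNormalFormOf r x m → IsNormalFormOf r x n →
      ReflTransGen b m n := by
    intro x m n hx hm hn
    by_cases hnx : IsNormalForm r x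
    · rw [hm.eq_of_isNormalForm hnx, hn.eq_of_isNormalForm hnx]
    · obtain ⟨t, ht, htm⟩ := hm.exists_step hnx
      obtain ⟨u, hu, hun⟩ := hn.exists_step hnx
      obtain ⟨v, hv, htv, hvu⟩ := hlocal x t u ht (Or.inl hu)
      refine valley t v m n (lt_of_step s x t hx ht) htv (fun k hk => ?_) htm
      refine valley v u k n (lt_of_step s x v hx hv) hvu (fun l hl => ?_) hk
      exact ih u (lt_of_step s x u hx hu) .refl hl hun
  have cliff : ∀ x y m n, ReflTransGen b s x → b x y → IsNormalFormOf r x m →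
      IsNormalFormOf r y n → ¬ IsNormalForm r x → ReflTransGen b m n := by
    intro x y m n hx hxy hm hn hnx
    obtain ⟨t, ht, htm⟩ := hm.exists_step hnx
    obtain ⟨v, hv, htv, hvy⟩ := hlocal x t y ht (Or.inr hxy)
    refine valley t v m n (lt_of_step s x t hx ht) htv (fun k hk => ?_) htm
    refine valley v y k n (lt_of_step s x v hx hv) hvy (fun l hl => ?_) hk
    exact unique y l n (hx.tail hxy) hl hn
  induction hxy generalizing n with
  | refl => exact unique s m n .refl hm hn
  | @tail x y hsx hxy ihxy =>
    obtain ⟨k, hk⟩ := hnf x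
    refine (ihxy hk).trans ?_
    by_cases hx : IsNormalForm r x
    · by_cases hy : IsNormalForm r y
      · rw [hk.eq_of_isNormalForm hx, hn.eq_of_isNormalForm hy]
        exact .single hxy
      -- A cliff needs a reducible source, so it is read backwards when only `y` is reducible.
      · exact hsymm _ _ (cliff y x n k (hsx.tail hxy) (hb _ _ hxy) hn hk hy)
    · exact cliff x y k n hsx hxy hk hn hx

/-- A relation that terminates modulo `∼` is Church–Rosser modulo `∼` if local peaks and local
cliffs decompose into two valleys via a reduct of their source. -/
theorem churchRosserModulo_of_local (hb : ∀ x y, b x y → b y x)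
    (hterm : TerminatingModulo r (ReflTransGen b))
    (hlocal : ∀ s t u, r s t → r s u ∨ b s u → ∃ v, r s v ∧
      Valley r (ReflTransGen b) t v ∧ Valley r (ReflTransGen b) v u) :
    ChurchRosserModulo r (ReflTransGen b) := by
  intro x y hxy
  have hnf := hterm.exists_isNormalFormOf fun _ => .refl
  have key := @equiv_of_isNormalFormOf A r b hb hterm hlocal
  obtain ⟨m, hm⟩ := hnf x
  obtain ⟨n, hn⟩ := hnf y
  refine ⟨m, n, hm.1, ?_, hn.1⟩
  induction hxy generalizing n with
  | refl => exact key .refl hm hn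
  | tail _ h ih =>
    obtain ⟨k, hk⟩ := hnf _
    refine (ih k hk).trans ?_
    rcases h with h | h | h
    · exact key .refl (hk.of_reflTransGen (.single h)) hn
    · exact key .refl hk (hn.of_reflTransGen (.single h))
    · exact key h hk hn

end AbstractChurchRosser

/-! ### Critical pairs as conversions, and the symmetric closure of `B` -/

section Main

variable {L : FirstOrder.Language} {V : Type*} {R B : ES L V}

theorem valley_of_mem_primeCPs {E₁ E₂ : ES L V}
    (hCR : ChurchRosserModulo (Step R) (EqTheory B))
    (h₁ : ∀ a b, Step E₁ a b → ConversionStep (Step R) (EqTheory B) b a)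
    (h₂ : ∀ a b, Step E₂ a b → ConversionStep (Step R) (EqTheory B) a b)
    {c : L.Term V × L.Term V} (hc : c ∈ primeCPs R E₁ E₂) :
    Valley (Step R) (EqTheory B) c.1 c.2 := by
  obtain ⟨p, s, hpeak, -⟩ := hc
  exact hCR _ _ (.head (h₁ _ _ hpeak.steps.1) (.single (h₂ _ _ hpeak.steps.2)))

theorem eqTheory_eq_reflTransGen_step_symmES (B : ES L V) :
    EqTheory B = ReflTransGen (Step (symmES B)) := by
  have h : Relation.SymmGen (Step B) = Step (symmES B) := by
    funext a b
    exact propext step_symmES.symm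
  rw [EqTheory, h]

theorem step_symmES_symm {a b : L.Term V} (h : Step (symmES B) a b) : Step (symmES B) b a :=
  step_symmES.2 (step_symmES.1 h).symm

end Main

end TermRewriting

open TermRewriting in
theorem mainTheorem1 {L : FirstOrder.Language} {V : Type*} [Infinite V]
    (R B : TermRewriting.ES L V)
    (hR : TermRewriting.IsTRS R)
    (hlin : TermRewriting.IsLeftLinear R)
    (hB : ∀ e ∈ B, TermRewriting.vars e.1 = TermRewriting.vars e.2)
    (hterm : TermRewriting.TerminatingModulo (TermRewriting.Step R) (TermRewriting.EqTheory B)) :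
    TermRewriting.ChurchRosserModulo (TermRewriting.Step R) (TermRewriting.EqTheory B) ↔
      TermRewriting.PCP R ∪ TermRewriting.PCPpm R (TermRewriting.symmES B) ⊆
        {e | TermRewriting.Valley (TermRewriting.Step R) (TermRewriting.EqTheory B) e.1 e.2} := by
  have hBstep : ∀ a b, Step (symmES B) a b → EqTheory B a b := fun a b h => by
    rw [eqTheory_eq_reflTransGen_step_symmES]
    exact .single h
  constructor
  · have hR₁ : ∀ a b, Step R a b → ConversionStep (Step R) (EqTheory B) b a :=
      fun a b h => Or.inl h
    have hR₂ : ∀ a b, Step R a b → ConversionStep (Step R) (EqTheory B) a b :=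
      fun a b h => Or.inr (Or.inl h)
    rintro hCR c (hc | hc | hc)
    · exact valley_of_mem_primeCPs hCR hR₁ hR₂ hc
    · exact valley_of_mem_primeCPs hCR hR₁ (fun a b h => Or.inr (Or.inr (hBstep a b h))) hc
    · exact valley_of_mem_primeCPs hCR
        (fun a b h => Or.inr (Or.inr (hBstep b a (step_symmES_symm h)))) hR₂ hc
  · intro h
    have hvars : ∀ ρ ∈ symmES B, vars ρ.2 ⊆ vars ρ.1 := by
      rintro ρ (hρ | hρ)
      · exact (hB ρ hρ).ge
      · exact (hB ρ.swap hρ).le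
    have hctx : ClosedUnderContexts (Valley (Step R) (EqTheory B)) :=
      closedUnderContexts_step.valley closedUnderContexts_step.symmGen.reflTransGen
    have hsubst : ClosedUnderSubst (Valley (Step R) (EqTheory B)) :=
      closedUnderSubst_step.valley closedUnderSubst_step.symmGen.reflTransGen
    have hsymm : ∀ a b, EqTheory B a b → EqTheory B b a := fun a b h =>
      (Relation.ReflTransGen.stdSymm (r := Relation.SymmGen (Step B))).symm a b h
    have hPR : ∀ {p q s t u}, StepAt R p s t → StepAt R q s u → IsPrimePeak R p s →
        Valley (Step R) (EqTheory B) t u := fun ht hu hp =>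
      valley_of_primeCPs (fun _ => .refl) hsymm hctx hsubst
        (fun a b hab => ⟨b, b, hab, .refl, .refl⟩) hlin (fun ρ hρ => (hR ρ hρ).2)
        (fun ρ hρ => (hR ρ hρ).2) (fun c hc => h (Or.inl hc)) (fun c hc => h (Or.inl hc)) ht hu hp
    have hPB : ∀ {p q s t u}, StepAt R p s t → StepAt (symmES B) q s u → IsPrimePeak R p s →
        Valley (Step R) (EqTheory B) t u := fun ht hu hp =>
      valley_of_primeCPs (fun _ => .refl) hsymm hctx hsubst
        (fun a b hab => ⟨a, b, .refl, by rwa [eqTheory_eq_reflTransGen_step_symmES], .refl⟩)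
        hlin (fun ρ hρ => (hR ρ hρ).2) hvars
        (fun c hc => h (Or.inr (Or.inl hc))) (fun c hc => h (Or.inr (Or.inr hc))) ht hu hp
    rw [eqTheory_eq_reflTransGen_step_symmES] at *
    refine churchRosserModulo_of_local (fun x y h => step_symmES_symm h) hterm
      fun s t u ⟨p, ht⟩ hu => ?_
    -- The innermost reduct `v` splits the peak or cliff into two, each with a prime step.
    obtain ⟨p', v, hv, hp'⟩ := exists_innermost_step ⟨p, ht⟩
    refine ⟨v, ⟨p', hv⟩, (hPR hv ht hp').symm hsymm, ?_⟩
    rcases hu with ⟨q, hu⟩ | ⟨q, hu⟩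
    · exact hPR hv hu hp'
    · exact hPB hv hu hp'
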